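/- Let $k,n\ge 1$ be integers, $m=(m_1,\dots,m_n)\in\mathbb Z_{>0}^n$, $|m|=m_1+\dots+m_n$, and let $p$ be a prime with $p>|m|$. Let $e,f,h$ be the standard basis of $\mathfrak{sl}_2$ over $\mathbb F_p$. For an integer $i\ge 0$ let $L_i$ be the $\mathfrak{sl}_2$-module over $\mathbb F_p$ with basis $v_i,fv_i,\dots,f^iv_i$ and action $h\cdot f^jv_i=(i-2j)f^jv_i$, $f\cdot f^jv_i=f^{j+1}v_i$ for $j<i$, $f\cdot f^iv_i=0$, $e\cdot v_i=0$, $e\cdot f^jv_i=j(i-j+1)f^{j-1}v_i$ for $1\le j\le i$. Put $L^{\otimes m}=L_{m_1}\otimes\dots\otimes L_{m_n}$, let $x\in\mathfrak{sl}_2$ act on it by the sum of its actions in the factors, and for $w\in\mathbb Z$ let $$\operatorname{Sing}L^{\otimes m}[w]=\{v\in L^{\otimes m}\mid h\cdot v=wv,\ e\cdot v=0\}.$$ Let $z^0=(z^0_1,\dots,z^0_n)\in\mathbb F_p^n$ have distinct coordinates. For $s=1,\dots,n$ let $$H_s(z^0)=\sum_{l\ne s}\frac{\Omega^{(s,l)}}{z^0_s-z^0_l},$$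 acting on $L^{\otimes m}$, where $\Omega^{(s,l)}$ acts as $\Omega=e\otimes f+f\otimes e+\tfrac12\,h\otimes h$ in the $s$-th and $l$-th factors and as the identity in the others. (If $n=1$, then $H_1(z^0)=0$; if $n\ge2$, then $p>2$.) Let $t^0=(t^0_1,\dots,t^0_k)\in\mathbb F_p^k$ be a solution of the Bethe ansatz equations, that is, $t^0_1,\dots,t^0_k,z^0_1,\dots,z^0_n$ are pairwise distinct and $$\sum_{j\ne i}\frac{2}{t^0_i-t^0_j}-\sum_{s=1}^n\frac{m_s}{t^0_i-z^0_s}=0,\qquad i=1,\dots,k.$$ For $r\ge0$ let $\mathcal I_r$ be the set of $J=(j_1,\dots,j_n)\in\mathbb Z_{\ge0}^n$ with $j_1+\dots+j_n=r$ and $j_s\le m_s$ for all $s$. For $J\in\mathcal I_k$ let $$W_J(t^0,z^0)=\frac1{j_1!\cdots j_n!}\sum_{\sigma\in S_k}\ \prod_{s=1}^n\prod_{i=1}^{j_s}\frac1{t^0_{\sigma(j_1+\dots+j_{s-1}+i)}-z^0_s},$$ let $W_J(t^0,z^0)=0$ for $J\notin\mathcal I_k$, and let $$W_{k,n,m}(t^0,z^0)=\sum_{J\in\mathcal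 I_k}W_J(t^0,z^0)\;f^{j_1}v_{m_1}\otimes\dots\otimes f^{j_n}v_{m_n}.$$ Then the vector $W_{k,n,m}(t^0,z^0)$ is well defined over $\mathbb F_p$ (all the differences $t^0_i-z^0_s$, and the products $j_1!\cdots j_n!$ for $J\in\mathcal I_k$, are nonzero in $\mathbb F_p$), and it lies in $\operatorname{Sing}L^{\otimes m}[|m|-2k]$; in terms of its coordinates, $$\sum_{s=1}^n(j_s+1)(m_s-j_s)\,W_{J+\mathbf 1_s}(t^0,z^0)=0\qquad\text{for all }J\in\mathcal I_{k-1},$$ where $\mathbf 1_s$ is the $s$-th standard unit vector. Moreover, $$H_s(z^0)\,W_{k,n,m}(t^0,z^0)=\lambda_s(t^0,z^0)\,W_{k,n,m}(t^0,z^0),\qquad s=1,\dots,n,$$ where $$\lambda_s(t^0,z^0)=\sum_{l\ne s}\frac{m_sm_l/2}{z^0_s-z^0_l}-\sum_{i=1}^k\frac{m_s}{z^0_s-t^0_i}.$$ -/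

import Mathlib

open scoped TensorProduct

noncomputable section

namespace GaudinModel

attribute [local instance 100] LieRing.ofAssociativeRing

variable {F : Type*} [Field F]

/-! The Lie algebra of traceless two by two matrices, with its standard basis `e, f, h`. -/

/-- The Lie algebra `sl₂` over the field `F`. -/
abbrev Sl2 (F : Type*) [Field F] : Type _ := LieAlgebra.SpecialLinear.sl (Fin 2) F

/-- The standard basis element `e` of `sl₂`. -/
def slE (F : Type*) [Field F] : Sl2 F :=
  ⟨!![0, 1; 0, 0], by
    change Matrix.trace (!![0, 1; 0, 0] : Matrix (Fin 2) (Fin 2) F) = 0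
    simp [Matrix.trace_fin_two]⟩

/-- The standard basis element `f` of `sl₂`. -/
def slF (F : Type*) [Field F] : Sl2 F :=
  ⟨!![0, 0; 1, 0], by
    change Matrix.trace (!![0, 0; 1, 0] : Matrix (Fin 2) (Fin 2) F) = 0
    simp [Matrix.trace_fin_two]⟩

/-- The standard basis element `h` of `sl₂`. -/
def slH (F : Type*) [Field F] : Sl2 F :=
  ⟨!![1, 0; 0, -1], by
    change Matrix.trace (!![1, 0; 0, -1] : Matrix (Fin 2) (Fin 2) F) = 0
    simp [Matrix.trace_fin_two]⟩

/-! The `(i+1)`-dimensional module `L_i`. -/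

/-- The underlying vector space of `L_i`; its standard basis is `v_i, f v_i, …, f^i v_i`. -/
abbrev IrrModule (F : Type*) [Field F] (i : ℕ) : Type _ := Fin (i + 1) → F

/-- The vector `f^j v_i` of `L_i`; it is a basis vector for `j ≤ i`, and zero for `j > i`. -/
def fPow (F : Type*) [Field F] (i j : ℕ) : IrrModule F i :=
  if hj : j < i + 1 then Pi.single ⟨j, hj⟩ 1 else 0

/-- The operator by which `f` acts on `L_i`: `f^j v_i ↦ f^(j+1) v_i` (zero for `j = i`). -/
def opF (F : Type*) [Field F] (i : ℕ) : Module.End F (IrrModule F i) :=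
  (Pi.basisFun F (Fin (i + 1))).constr F fun j => fPow F i (j + 1)

/-- The operator by which `e` acts on `L_i`: `f^j v_i ↦ j (i - j + 1) f^(j-1) v_i`
(zero for `j = 0`). -/
def opE (F : Type*) [Field F] (i : ℕ) : Module.End F (IrrModule F i) :=
  (Pi.basisFun F (Fin (i + 1))).constr F fun j =>
    ((j : ℕ) * ((i : F) - (j : ℕ) + 1) : F) • fPow F i (j - 1)

/-- The operator by which `h` acts on `L_i`: `f^j v_i ↦ (i - 2 j) f^j v_i`. -/
def opH (F : Type*) [Field F] (i : ℕ) : Module.End F (IrrModule F i) :=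
  (Pi.basisFun F (Fin (i + 1))).constr F fun j => ((i : F) - 2 * (j : ℕ)) • fPow F i j

theorem fPow_eq_zero {i j : ℕ} (h : i < j) : fPow F i j = 0 :=
  dif_neg (by omega)

theorem basisFun_eq_fPow (i : ℕ) (j : Fin (i + 1)) :
    Pi.basisFun F (Fin (i + 1)) j = fPow F i j := by
  simp [fPow, j.2]

theorem opF_fPow (i j : ℕ) : opF F i (fPow F i j) = fPow F i (j + 1) := by
  by_cases h : j < i + 1
  · have := basisFun_eq_fPow (F := F) i ⟨j, h⟩
    rw [← this, opF, Module.Basis.constr_basis]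
  · rw [fPow_eq_zero (by omega), fPow_eq_zero (by omega), map_zero]

theorem opE_fPow (i j : ℕ) :
    opE F i (fPow F i j) = ((j : F) * ((i : F) - j + 1)) • fPow F i (j - 1) := by
  by_cases h : j < i + 1
  · have := basisFun_eq_fPow (F := F) i ⟨j, h⟩
    rw [← this, opE, Module.Basis.constr_basis]
  · rw [fPow_eq_zero (j := j) (by omega), map_zero]
    by_cases h2 : j = i + 1
    · subst h2
      simp
    · rw [fPow_eq_zero (by omega), smul_zero]

theorem opH_fPow (i j : ℕ) : opH F i (fPow F i j) = ((i : F) - 2 * j) • fPow F i j := by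
  by_cases h : j < i + 1
  · have := basisFun_eq_fPow (F := F) i ⟨j, h⟩
    rw [← this, opH, Module.Basis.constr_basis, basisFun_eq_fPow]
  · rw [fPow_eq_zero (by omega), map_zero, smul_zero]

theorem irr_ext {i : ℕ} {A B : Module.End F (IrrModule F i)}
    (h : ∀ j, A (fPow F i j) = B (fPow F i j)) : A = B :=
  (Pi.basisFun F (Fin (i + 1))).ext fun j => by rw [basisFun_eq_fPow, h]

theorem lie_opE_opF (i : ℕ) : ⁅opE F i, opF F i⁆ = opH F i := by
  refine irr_ext fun j => ?_
  rw [LieRing.of_associative_ring_bracket, LinearMap.sub_apply, Module.End.mul_apply,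
    Module.End.mul_apply, opF_fPow, opE_fPow, opE_fPow, opH_fPow, map_smul, opF_fPow]
  rcases j with _ | j
  · simp
  · simp only [Nat.add_sub_cancel, ← sub_smul]
    congr 1
    push_cast
    ring

theorem lie_opH_opE (i : ℕ) : ⁅opH F i, opE F i⁆ = (2 : F) • opE F i := by
  refine irr_ext fun j => ?_
  rw [LieRing.of_associative_ring_bracket, LinearMap.sub_apply, Module.End.mul_apply,
    Module.End.mul_apply, LinearMap.smul_apply, opH_fPow, opE_fPow, map_smul, map_smul, opH_fPow,
    opE_fPow]
  rcases j with _ | j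
  · simp
  · simp only [Nat.add_sub_cancel, smul_smul, ← sub_smul]
    congr 1
    push_cast
    ring

theorem lie_opH_opF (i : ℕ) : ⁅opH F i, opF F i⁆ = (-2 : F) • opF F i := by
  refine irr_ext fun j => ?_
  rw [LieRing.of_associative_ring_bracket, LinearMap.sub_apply, Module.End.mul_apply,
    Module.End.mul_apply, LinearMap.smul_apply, opH_fPow, opF_fPow, map_smul, opH_fPow,
    opF_fPow, ← sub_smul]
  congr 1
  push_cast
  ring

/-- The action of `sl₂` on `L_i`: the matrix `(a, b; c, -a)` acts as `a h + b e + c f`. -/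
def irrRep (F : Type*) [Field F] (i : ℕ) : Sl2 F →ₗ⁅F⁆ Module.End F (IrrModule F i) where
  toFun x := x.1 0 0 • opH F i + x.1 0 1 • opE F i + x.1 1 0 • opF F i
  map_add' x y := by
    have h : ∀ a b, (x + y).1 a b = x.1 a b + y.1 a b := fun _ _ => rfl
    rw [h, h, h]
    module
  map_smul' c x := by
    have h : ∀ a b, (c • x).1 a b = c * x.1 a b := fun _ _ => rfl
    rw [h, h, h, RingHom.id_apply]
    module
  map_lie' := by
    intro x y
    have tr : ∀ w : Sl2 F, w.1 1 1 = - w.1 0 0 := by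
      intro w
      have h : Matrix.trace (w.1 : Matrix (Fin 2) (Fin 2) F) = 0 := w.2
      rw [Matrix.trace_fin_two] at h
      exact eq_neg_of_add_eq_zero_right h
    have hb : ∀ a b, (⁅x, y⁆ : Sl2 F).1 a b =
        (x.1 a 0 * y.1 0 b + x.1 a 1 * y.1 1 b) - (y.1 a 0 * x.1 0 b + y.1 a 1 * x.1 1 b) := by
      intro a b
      have h : (⁅x, y⁆ : Sl2 F).1 a b = ((x.1 : Matrix (Fin 2) (Fin 2) F) * y.1 -
        (y.1 : Matrix (Fin 2) (Fin 2) F) * x.1) a b := rfl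
      rw [h, Matrix.sub_apply, Matrix.mul_apply, Matrix.mul_apply, Fin.sum_univ_two,
        Fin.sum_univ_two]
    have h1 := lie_opE_opF (F := F) i
    have h2 := lie_opH_opE (F := F) i
    have h3 := lie_opH_opF (F := F) i
    rw [LieRing.of_associative_ring_bracket, sub_eq_iff_eq_add] at h1 h2 h3
    rw [LieRing.of_associative_ring_bracket, hb, hb, hb, tr x, tr y]
    simp only [mul_add, add_mul, smul_mul_assoc, mul_smul_comm, h1, h2, h3]
    module

/-! The tensor product `L^{⊗m}` and the operators acting on it. -/

/-- The tensor product `L_{m_1} ⊗ … ⊗ L_{m_n}`. -/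
abbrev TensorModule (F : Type*) [Field F] {n : ℕ} (m : Fin n → ℕ) : Type _ :=
  ⨂[F] s : Fin n, IrrModule F (m s)

/-- The action of `x ∈ sl₂` in the `s`-th tensor factor, `1 ⊗ … ⊗ x ⊗ … ⊗ 1`. -/
def actAt {n : ℕ} (m : Fin n → ℕ) (s : Fin n) (x : Sl2 F) : Module.End F (TensorModule F m) :=
  PiTensorProduct.map (Function.update (fun _ => LinearMap.id) s (irrRep F (m s) x))

/-- The action of `x ∈ sl₂` on the tensor product, `x ⊗ 1 ⊗ … ⊗ 1 + … + 1 ⊗ … ⊗ 1 ⊗ x`. -/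
def tensorAct {n : ℕ} (m : Fin n → ℕ) (x : Sl2 F) : Module.End F (TensorModule F m) :=
  ∑ s, actAt m s x

/-- The action of `Ω^{(s,l)}`, that is, of the Casimir element
`Ω = e ⊗ f + f ⊗ e + (1/2) h ⊗ h` in the distinct factors `s` and `l`. -/
def casimirAct {n : ℕ} (m : Fin n → ℕ) (s l : Fin n) : Module.End F (TensorModule F m) :=
  actAt m s (slE F) * actAt m l (slF F) + actAt m s (slF F) * actAt m l (slE F)
    + (1 / 2 : F) • (actAt m s (slH F) * actAt m l (slH F))

/-- The Gaudin Hamiltonian `H_s(z) = ∑_{l ≠ s} Ω^{(s,l)} / (z_s - z_l)` acting on `L^{⊗m}`. -/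
def hamiltonian {n : ℕ} (m : Fin n → ℕ) (z : Fin n → F) (s : Fin n) :
    Module.End F (TensorModule F m) :=
  ∑ l ∈ Finset.univ.erase s, (z s - z l)⁻¹ • casimirAct m s l

/-- The weight subspace `L^{⊗m}[w] = {v | h.v = w v}` for an integer `w`. -/
def weightSpace (F : Type*) [Field F] {n : ℕ} (m : Fin n → ℕ) (w : ℤ) :
    Submodule F (TensorModule F m) :=
  LinearMap.ker (tensorAct m (slH F) - (w : F) • (1 : Module.End F (TensorModule F m)))

/-- The singular weight subspace `Sing L^{⊗m}[w] = {v ∈ L^{⊗m}[w] | e.v = 0}`. -/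
def singSpace (F : Type*) [Field F] {n : ℕ} (m : Fin n → ℕ) (w : ℤ) :
    Submodule F (TensorModule F m) :=
  weightSpace F m w ⊓ LinearMap.ker (tensorAct m (slE F))

/-! Weight functions and the Bethe vector. -/

/-- The set `I_k` of multi-indices `J` with `|J| = k` and `j_s ≤ m_s` for all `s`. -/
def indexSet {n : ℕ} (m : Fin n → ℕ) (k : ℕ) : Finset (Fin n → ℕ) :=
  (Fintype.piFinset fun s => Finset.range (m s + 1)).filter fun J => ∑ s, J s = k

theorem mem_indexSet {n : ℕ} {m : Fin n → ℕ} {k : ℕ} {J : Fin n → ℕ} :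
    J ∈ indexSet m k ↔ (∀ s, J s ≤ m s) ∧ ∑ s, J s = k := by
  simp [indexSet]

/-- The basis vector `f_J v_m = f^{j_1} v_{m_1} ⊗ … ⊗ f^{j_n} v_{m_n}`. -/
def fVec (F : Type*) [Field F] {n : ℕ} (m J : Fin n → ℕ) : TensorModule F m :=
  PiTensorProduct.tprod F fun s => fPow F (m s) (J s)

/-- The weight function `W_J(t, z)` for `J ∈ I_k`,
`(1 / (j_1! ⋯ j_n!)) ∑_σ ∏_s ∏_{i=1}^{j_s} 1 / (t_{σ(j_1 + ⋯ + j_{s-1} + i)} - z_s)`,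
and zero for `J ∉ I_k`. The (zero-based) position `j_1 + ⋯ + j_{s-1} + i` is
`finSigmaFinEquiv ⟨s, i⟩`. -/
def weightFun {n : ℕ} (m : Fin n → ℕ) {k : ℕ} (t : Fin k → F) (z : Fin n → F)
    (J : Fin n → ℕ) : F :=
  if hJ : J ∈ indexSet m k then
    (∏ s, ((J s).factorial : F))⁻¹ * ∑ σ : Equiv.Perm (Fin k), ∏ s, ∏ i : Fin (J s),
      (t (σ (Fin.cast (mem_indexSet.1 hJ).2 (finSigmaFinEquiv ⟨s, i⟩))) - z s)⁻¹
  else 0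

/-- The vector `W_{k,n,m}(t, z) = ∑_{J ∈ I_k} W_J(t, z) f_J v_m`. -/
def betheVector {n : ℕ} (m : Fin n → ℕ) {k : ℕ} (t : Fin k → F) (z : Fin n → F) :
    TensorModule F m :=
  ∑ J ∈ indexSet m k, weightFun m t z J • fVec F m J

/-- All the denominators in the formula defining `W_{k,n,m}(t, z)` are nonzero in `F`: the
differences `t_i - z_s`, and the products `j_1! ⋯ j_n!` for `J ∈ I_k`. -/
def BetheVectorDefined {n : ℕ} (m : Fin n → ℕ) {k : ℕ} (t : Fin k → F) (z : Fin n → F) : Prop :=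
  (∀ i s, t i - z s ≠ 0) ∧ ∀ J ∈ indexSet m k, ∏ s, ((J s).factorial : F) ≠ 0

/-- `t` solves the Bethe ansatz equations
`∑_{j ≠ i} 2 / (t_i - t_j) - ∑_s m_s / (t_i - z_s) = 0`, `i = 1, …, k`. The first two fields say
that the denominators are nonzero. -/
structure IsBetheSolution {n : ℕ} (m : Fin n → ℕ) {k : ℕ} (t : Fin k → F) (z : Fin n → F) :
    Prop where
  injective : Function.Injective t
  ne : ∀ i s, t i ≠ z s
  equation : ∀ i, ∑ j ∈ Finset.univ.erase i, 2 / (t i - t j) - ∑ s, (m s : F) / (t i - z s) = 0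

/-- The number
`λ_s(t, z) = ∑_{l ≠ s} (m_s m_l / 2) / (z_s - z_l) - ∑_i m_s / (z_s - t_i)`. -/
def eigenvalue {n : ℕ} (m : Fin n → ℕ) {k : ℕ} (t : Fin k → F) (z : Fin n → F) (s : Fin n) : F :=
  ∑ l ∈ Finset.univ.erase s, ((m s : F) * (m l : F) / 2) / (z s - z l)
    - ∑ i, (m s : F) / (z s - t i)

end GaudinModel

end

open scoped TensorProduct

noncomputable section

namespace GaudinModel

open MvPolynomial Finset

variable {F : Type*} [Field F] {n : ℕ}

/-! The proof lifts the problem to polynomials. The map `evalVec` sends `X^J` to `f_J v_m`, and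
kills monomials with some `J_s > m_s`. Under it `f`, `h`, `e` in factor `s` become the differential
operators `X_s`, `m_s - 2 X_s ∂_s`, `m_s ∂_s - X_s ∂_s²`; this is a tensor product of Verma modules.
The Bethe vector is the image of `∏_i L(t_i)` with `L(a) = ∑_s X_s / (a - z_s)`
(`betheVector_eq_evalVec`): expanding the product gives a sum over maps from points to factors, and
dividing the sum over `S_k` by `∏ j_s!` gives the same sum. For an arbitrary finite set of distinct
points `t_j` off the `z_s`, induction on the set, commuting one factor `L(t_a)` past the operators,
gives off-shell formulas (`sum_polyE_polyPhi`, `polyHam_polyPhi`): `e` gives no term, and `H_s` only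
the eigenvalue term, beyond a sum weighted by the defects of the Bethe equations. At a solution all
defects vanish. The bound `p > |m|` makes the factorials invertible, and also `2` as soon as two
factors are present. -/

/-! ### Action of `e`, `f`, `h` on the standard tensors -/

theorem irrRep_slE (i : ℕ) : irrRep F i (slE F) = opE F i := by
  change (0 : F) • opH F i + (1 : F) • opE F i + (0 : F) • opF F i = _
  simp

theorem irrRep_slF (i : ℕ) : irrRep F i (slF F) = opF F i := by
  change (0 : F) • opH F i + (0 : F) • opE F i + (1 : F) • opF F i = _
  simp

theorem irrRep_slH (i : ℕ) : irrRep F i (slH F) = opH F i := by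
  change (1 : F) • opH F i + (0 : F) • opE F i + (0 : F) • opF F i = _
  simp

theorem fVec_update (m J : Fin n → ℕ) (s : Fin n) (j : ℕ) :
    fVec F m (Function.update J s j) =
      PiTensorProduct.tprod F (Function.update (fun r => fPow F (m r) (J r)) s (fPow F (m s) j)) := by
  rw [fVec]
  congr 1
  funext r
  by_cases h : r = s
  · subst h; simp
  · simp [h]

theorem actAt_fVec (m J : Fin n → ℕ) (s : Fin n) (x : Sl2 F) :
    actAt m s x (fVec F m J) = PiTensorProduct.tprod F
      (Function.update (fun r => fPow F (m r) (J r)) s (irrRep F (m s) x (fPow F (m s) (J s)))) := by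
  rw [actAt, fVec, PiTensorProduct.map_tprod]
  congr 1
  funext r
  by_cases h : r = s
  · subst h; simp
  · simp [h]

theorem actAt_slF_fVec (m J : Fin n → ℕ) (s : Fin n) :
    actAt m s (slF F) (fVec F m J) = fVec F m (Function.update J s (J s + 1)) := by
  rw [actAt_fVec, irrRep_slF, opF_fPow, fVec_update]

theorem actAt_slE_fVec (m J : Fin n → ℕ) (s : Fin n) :
    actAt m s (slE F) (fVec F m J) =
      ((J s : F) * ((m s : F) - J s + 1)) • fVec F m (Function.update J s (J s - 1)) := by
  rw [actAt_fVec, irrRep_slE, opE_fPow, fVec_update, MultilinearMap.map_update_smul]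

theorem actAt_slH_fVec (m J : Fin n → ℕ) (s : Fin n) :
    actAt m s (slH F) (fVec F m J) = ((m s : F) - 2 * J s) • fVec F m J := by
  rw [actAt_fVec, irrRep_slH, opH_fPow, MultilinearMap.map_update_smul, ← fVec_update,
    Function.update_eq_self]

theorem fVec_eq_zero {m J : Fin n → ℕ} {s : Fin n} (h : m s < J s) : fVec F m J = 0 :=
  MultilinearMap.map_coord_zero _ s (fPow_eq_zero h)

/-! ### Lift to differential operators on polynomials -/

/-- The linear map from polynomials to the tensor product sending `X^J` to `f_J v_m`. -/
def evalVec (F : Type*) [Field F] (m : Fin n → ℕ) :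
    MvPolynomial (Fin n) F →ₗ[F] TensorModule F m :=
  (basisMonomials (Fin n) F).constr F fun J => fVec F m J

theorem evalVec_monomial (m : Fin n → ℕ) (J : Fin n →₀ ℕ) (c : F) :
    evalVec F m (monomial J c) = c • fVec F m J := by
  have h : monomial J c = c • basisMonomials (Fin n) F J := by
    simp [smul_monomial]
  rw [h, map_smul, evalVec, Module.Basis.constr_basis]

/-- The operator on polynomials corresponding to the action of `h` in the `s`-th factor. -/
def polyH (m : Fin n → ℕ) (s : Fin n) (P : MvPolynomial (Fin n) F) : MvPolynomial (Fin n) F :=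
  C (m s : F) * P - 2 * X s * pderiv s P

/-- The operator on polynomials corresponding to the action of `e` in the `s`-th factor. -/
def polyE (m : Fin n → ℕ) (s : Fin n) (P : MvPolynomial (Fin n) F) : MvPolynomial (Fin n) F :=
  C (m s : F) * pderiv s P - X s * pderiv s (pderiv s P)

theorem actAt_slF_evalVec (m : Fin n → ℕ) (s : Fin n) (P : MvPolynomial (Fin n) F) :
    actAt m s (slF F) (evalVec F m P) = evalVec F m (X s * P) := by
  induction P using MvPolynomial.induction_on' with
  | add p q hp hq => simp only [map_add, mul_add, hp, hq]
  | monomial J c =>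
    rw [X, monomial_mul, one_mul, evalVec_monomial, evalVec_monomial, map_smul, actAt_slF_fVec]
    congr 2
    funext r
    by_cases h : r = s
    · subst h; simp [add_comm]
    · simp [h]

theorem X_mul_pderiv_monomial (s : Fin n) (J : Fin n →₀ ℕ) (c : F) :
    X s * pderiv s (monomial J c) = monomial J (c * J s) := by
  rw [pderiv_monomial, X, monomial_mul, one_mul]
  -- Truncated subtraction spoils the exponent when `J s = 0`, but then the coefficient vanishes.
  by_cases h : J s = 0
  · simp [h]
  · have e : Finsupp.single s 1 + (J - Finsupp.single s 1) = J :=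
      add_tsub_cancel_of_le (Finsupp.single_le_iff.2 (Nat.one_le_iff_ne_zero.2 h))
    rw [e]

theorem actAt_slH_evalVec (m : Fin n → ℕ) (s : Fin n) (P : MvPolynomial (Fin n) F) :
    actAt m s (slH F) (evalVec F m P) = evalVec F m (polyH m s P) := by
  unfold polyH
  induction P using MvPolynomial.induction_on' with
  | add p q hp hq =>
    rw [map_add, map_add, hp, hq, ← map_add]
    congr 1
    simp only [map_add]
    ring
  | monomial J c =>
    have h : C (m s : F) * monomial J c - 2 * X s * pderiv s (monomial J c) =
        monomial J (c * ((m s : F) - 2 * J s)) := by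
      rw [mul_assoc, X_mul_pderiv_monomial, C_mul_monomial, two_mul, ← map_add, ← map_sub]
      congr 1
      ring
    rw [h, evalVec_monomial, evalVec_monomial, map_smul, actAt_slH_fVec, smul_smul]

theorem actAt_slE_evalVec (m : Fin n → ℕ) (s : Fin n) (P : MvPolynomial (Fin n) F) :
    actAt m s (slE F) (evalVec F m P) = evalVec F m (polyE m s P) := by
  unfold polyE
  induction P using MvPolynomial.induction_on' with
  | add p q hp hq =>
    rw [map_add, map_add, hp, hq, ← map_add]
    congr 1
    simp only [map_add]
    ring
  | monomial J c =>
    have h : C (m s : F) * pderiv s (monomial J c) - X s * pderiv s (pderiv s (monomial J c)) =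
        monomial (J - Finsupp.single s 1) (c * ((J s : F) * ((m s : F) - J s + 1))) := by
      rw [pderiv_monomial, X_mul_pderiv_monomial, C_mul_monomial, ← map_sub]
      congr 1
      rcases hJ : J s with _ | j
      · simp
      · simp [hJ]
        ring
    rw [h, evalVec_monomial, evalVec_monomial, map_smul, actAt_slE_fVec, smul_smul]
    congr 2
    funext r
    by_cases h : r = s
    · subst h; simp
    · simp [h]

/-- The operator on polynomials corresponding to the Casimir element in two factors. -/
def polyOmega (m : Fin n → ℕ) (s l : Fin n) (P : MvPolynomial (Fin n) F) :
    MvPolynomial (Fin n) F :=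
  X l * polyE m s P + X s * polyE m l P + C (1 / 2 : F) * polyH m s (polyH m l P)

theorem polyE_X_mul (m : Fin n → ℕ) {s l : Fin n} (h : s ≠ l) (P : MvPolynomial (Fin n) F) :
    polyE m s (X l * P) = X l * polyE m s P := by
  simp only [polyE, pderiv_mul, pderiv_X_of_ne h.symm, zero_mul, zero_add]
  ring

theorem casimirAct_evalVec (m : Fin n → ℕ) {s l : Fin n} (h : s ≠ l)
    (P : MvPolynomial (Fin n) F) :
    casimirAct m s l (evalVec F m P) = evalVec F m (polyOmega m s l P) := by
  simp only [casimirAct, LinearMap.add_apply, LinearMap.smul_apply, Module.End.mul_apply,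
    actAt_slF_evalVec, actAt_slE_evalVec, actAt_slH_evalVec, polyE_X_mul m h, polyOmega, map_add,
    C_mul', map_smul]

/-! ### Products of creation forms: off-shell action of `e` -/

variable {ι : Type*} [DecidableEq ι]

/-- The linear form `∑_s X_s / (a - z_s)`, the symbol of the creation operator at `a`. -/
def polyL (z : Fin n → F) (a : F) : MvPolynomial (Fin n) F :=
  ∑ s, C (a - z s)⁻¹ * X s

/-- The product of the linear forms `∑_s X_s / (t_i - z_s)` over `i ∈ T`. -/
def polyPhi (z : Fin n → F) (t : ι → F) (T : Finset ι) : MvPolynomial (Fin n) F :=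
  ∏ i ∈ T, polyL z (t i)

/-- The left-hand side of the `i`-th Bethe equation for the points `t_j`, `j ∈ T`. -/
def betheDefect (m : Fin n → ℕ) (z : Fin n → F) (t : ι → F) (T : Finset ι) (i : ι) : F :=
  ∑ j ∈ T.erase i, 2 / (t i - t j) - ∑ s, (m s : F) / (t i - z s)

theorem pderiv_polyL (z : Fin n → F) (a : F) (s : Fin n) :
    pderiv s (polyL z a) = C (a - z s)⁻¹ := by
  simp only [polyL, map_sum, pderiv_C_mul, pderiv_X, Pi.single_apply]
  simp

theorem polyPhi_insert (z : Fin n → F) (t : ι → F) {T : Finset ι} {a : ι} (h : a ∉ T) :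
    polyPhi z t (insert a T) = polyL z (t a) * polyPhi z t T :=
  prod_insert h

theorem polyL_mul_polyPhi_erase (z : Fin n → F) (t : ι → F) {T : Finset ι} {j : ι} (h : j ∈ T) :
    polyL z (t j) * polyPhi z t (T.erase j) = polyPhi z t T :=
  mul_prod_erase T (fun i => polyL z (t i)) h

theorem sum_insert_erase {M : Type*} [AddCommMonoid M] (g : ι → Finset ι → M) {T : Finset ι}
    {a : ι} (h : a ∉ T) :
    ∑ j ∈ insert a T, g j ((insert a T).erase j) =
      g a T + ∑ j ∈ T, g j (insert a (T.erase j)) := by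
  rw [sum_insert h, erase_insert h]
  congr 1
  refine sum_congr rfl fun j hj => ?_
  rw [erase_insert_of_ne]
  rintro rfl
  exact h hj

theorem polyPhi_insert_erase (z : Fin n → F) (t : ι → F) {T : Finset ι} {a j : ι} (h : a ∉ T) :
    polyPhi z t (insert a (T.erase j)) = polyL z (t a) * polyPhi z t (T.erase j) :=
  polyPhi_insert z t fun h' => h (mem_of_mem_erase h')

theorem pderiv_polyPhi (z : Fin n → F) (t : ι → F) (T : Finset ι) (s : Fin n) :
    pderiv s (polyPhi z t T) = ∑ j ∈ T, C (t j - z s)⁻¹ * polyPhi z t (T.erase j) := by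
  induction T using Finset.induction_on with
  | empty => simp [polyPhi]
  | insert a T h ih =>
    rw [sum_insert_erase (fun j S => C (t j - z s)⁻¹ * polyPhi z t S) h, polyPhi_insert z t h,
      pderiv_mul, pderiv_polyL, ih, mul_sum]
    congr 1
    refine sum_congr rfl fun j _ => ?_
    rw [polyPhi_insert_erase z t h]
    ring

/-- Partial fractions: `1/((a - z)(b - z)) = (1/(b - z) - 1/(a - z))/(a - b)`. -/
theorem sum_inv_mul_X (z : Fin n → F) {a b : F} (hab : a ≠ b) (ha : ∀ s, a ≠ z s)
    (hb : ∀ s, b ≠ z s) :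
    ∑ s, C (a - z s)⁻¹ * (C (b - z s)⁻¹ * X s) =
      C (a - b)⁻¹ * (polyL z b - polyL z a) := by
  rw [polyL, polyL, ← sum_sub_distrib, mul_sum]
  refine sum_congr rfl fun s _ => ?_
  rw [← sub_mul, ← mul_assoc, ← mul_assoc, ← C_sub, ← C_mul, ← C_mul]
  congr 2
  have h1 := sub_ne_zero.2 hab
  have h2 := sub_ne_zero.2 (ha s)
  have h3 := sub_ne_zero.2 (hb s)
  field_simp
  ring

/-- The left side is the commutator of `∑_s e_s` with `L(t_a)`, applied to the product over `T`.
Each derivative in `h_s` removes some `L(t_j)`; by partial fractions the sum over `s` either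
restores it, contributing to the defect at `a`, or replaces it by `L(t_a)`. -/
theorem sum_polyH_polyPhi (m : Fin n → ℕ) (z : Fin n → F) (t : ι → F)
    (ht : Function.Injective t) (hz : ∀ i s, t i ≠ z s) {T : Finset ι} {a : ι} (h : a ∉ T) :
    ∑ s, C (t a - z s)⁻¹ * polyH m s (polyPhi z t T) =
      - C (betheDefect m z t (insert a T) a) * polyPhi z t T +
        ∑ j ∈ T, C (2 / (t a - t j)) * (polyL z (t a) * polyPhi z t (T.erase j)) := by
  have key : ∀ j ∈ T, C (2 / (t a - t j)) * (polyL z (t a) * polyPhi z t (T.erase j)) =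
      C (2 / (t a - t j)) * polyPhi z t T -
        2 * ∑ s, C (t a - z s)⁻¹ * (X s * (C (t j - z s)⁻¹ * polyPhi z t (T.erase j))) := by
    intro j hj
    have hja : t a ≠ t j := fun e => h (ht e ▸ hj)
    have := sum_inv_mul_X z hja (hz a) (hz j)
    have e : ∑ s, C (t a - z s)⁻¹ * (X s * (C (t j - z s)⁻¹ * polyPhi z t (T.erase j))) =
        (∑ s, C (t a - z s)⁻¹ * (C (t j - z s)⁻¹ * X s)) * polyPhi z t (T.erase j) := by
      rw [sum_mul]
      exact sum_congr rfl fun s _ => by ring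
    rw [e, this, ← polyL_mul_polyPhi_erase z t hj, div_eq_mul_inv, C_mul]
    simp only [map_ofNat]
    ring
  rw [sum_congr rfl key, sum_sub_distrib, ← mul_sum, sum_comm, betheDefect, erase_insert h]
  simp only [polyH, pderiv_polyPhi, mul_sub, sum_sub_distrib, map_sub, map_sum, neg_mul, sub_mul,
    sum_mul, mul_sum, div_eq_mul_inv, C_mul, map_ofNat]
  have e1 : ∀ s, C (t a - z s)⁻¹ * (C (m s : F) * polyPhi z t T) =
      C (m s : F) * C (t a - z s)⁻¹ * polyPhi z t T := fun s => by ring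
  have e2 : ∀ s j, C (t a - z s)⁻¹ * (2 * X s * (C (t j - z s)⁻¹ * polyPhi z t (T.erase j))) =
      2 * (C (t a - z s)⁻¹ * (X s * (C (t j - z s)⁻¹ * polyPhi z t (T.erase j)))) :=
    fun s j => by ring
  simp only [e1, e2]
  ring

theorem betheDefect_insert (m : Fin n → ℕ) (z : Fin n → F) (t : ι → F) {T : Finset ι} {a j : ι}
    (h : a ∉ T) (hj : j ∈ T) :
    betheDefect m z t (insert a T) j = betheDefect m z t T j + 2 / (t j - t a) := by
  have hne : a ≠ j := fun e => h (e ▸ hj)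
  rw [betheDefect, betheDefect, erase_insert_of_ne hne,
    sum_insert fun h' => h (mem_of_mem_erase h')]
  ring

theorem polyE_polyL_mul (m : Fin n → ℕ) (z : Fin n → F) (a : F) (s : Fin n)
    (P : MvPolynomial (Fin n) F) :
    polyE m s (polyL z a * P) = polyL z a * polyE m s P + C (a - z s)⁻¹ * polyH m s P := by
  simp only [polyE, polyH, pderiv_mul, pderiv_polyL, map_add, pderiv_C]
  ring

theorem polyH_polyL_mul (m : Fin n → ℕ) (z : Fin n → F) (a : F) (s : Fin n)
    (P : MvPolynomial (Fin n) F) :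
    polyH m s (polyL z a * P) = polyL z a * polyH m s P - 2 * X s * C (a - z s)⁻¹ * P := by
  simp only [polyH, pderiv_mul, pderiv_polyL]
  ring

/-- In the induction step the commutator with `L(t_a)` supplies the term removing `a`. Its exchange
terms `2/(t_a - t_j)` are exactly the changes in the other defects caused by adding `a`. -/
theorem sum_polyE_polyPhi (m : Fin n → ℕ) (z : Fin n → F) (t : ι → F)
    (ht : Function.Injective t) (hz : ∀ i s, t i ≠ z s) (T : Finset ι) :
    ∑ s, polyE m s (polyPhi z t T) =
      - ∑ j ∈ T, C (betheDefect m z t T j) * polyPhi z t (T.erase j) := by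
  induction T using Finset.induction_on with
  | empty => simp [polyPhi, polyE]
  | insert a T h ih =>
    rw [sum_insert_erase (fun j S => C (betheDefect m z t (insert a T) j) * polyPhi z t S) h,
      polyPhi_insert z t h]
    simp only [polyE_polyL_mul, sum_add_distrib, ← mul_sum]
    rw [ih, sum_polyH_polyPhi m z t ht hz h, neg_add, neg_mul, mul_neg, mul_sum, add_left_comm]
    congr 1
    rw [← sum_neg_distrib, ← sum_neg_distrib, ← sum_add_distrib]
    refine sum_congr rfl fun j hj => ?_
    rw [betheDefect_insert m z t h hj, polyPhi_insert_erase z t h, ← neg_sub (t a), div_neg,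
      C_add, C_neg]
    ring

/-! ### Off-shell action of the Gaudin Hamiltonians -/

/-- The operator on polynomials corresponding to the Gaudin Hamiltonian. -/
def polyHam (m : Fin n → ℕ) (z : Fin n → F) (s : Fin n) (P : MvPolynomial (Fin n) F) :
    MvPolynomial (Fin n) F :=
  ∑ l ∈ univ.erase s, C (z s - z l)⁻¹ * polyOmega m s l P

theorem hamiltonian_evalVec (m : Fin n → ℕ) (z : Fin n → F) (s : Fin n)
    (P : MvPolynomial (Fin n) F) :
    hamiltonian m z s (evalVec F m P) = evalVec F m (polyHam m z s P) := by
  rw [hamiltonian, polyHam, LinearMap.sum_apply, map_sum]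
  refine sum_congr rfl fun l hl => ?_
  rw [LinearMap.smul_apply, casimirAct_evalVec m (ne_of_mem_erase hl).symm, C_mul', map_smul]

/-- The Casimir commutes with `X_s + X_l`, so only the difference of the two coefficients in `L(a)`
survives, times the commutator of the Casimir with `X_s`. -/
theorem polyOmega_polyL_mul (h2 : (2 : F) ≠ 0) (m : Fin n → ℕ) (z : Fin n → F) (a : F)
    {s l : Fin n} (h : s ≠ l) (P : MvPolynomial (Fin n) F) :
    polyOmega m s l (polyL z a * P) = polyL z a * polyOmega m s l P +
      (C (a - z s)⁻¹ - C (a - z l)⁻¹) * (X l * polyH m s P - X s * polyH m l P) := by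
  have e : polyH m s (polyL z a * polyH m l P - 2 * X l * C (a - z l)⁻¹ * P) =
      polyH m s (polyL z a * polyH m l P) - 2 * C (a - z l)⁻¹ * (X l * polyH m s P) := by
    simp only [polyH, map_sub, pderiv_mul, pderiv_X_of_ne h.symm, pderiv_C, ← map_ofNat C 2]
    ring
  have hc : C (1 / 2 : F) * 2 = (1 : MvPolynomial (Fin n) F) := by
    rw [← map_ofNat C 2, ← C_mul, one_div_mul_cancel h2, C_1]
  simp only [polyOmega, polyE_polyL_mul]
  rw [polyH_polyL_mul, e, polyH_polyL_mul]
  linear_combination (-(X s * C (a - z s)⁻¹ * polyH m l P) -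
    C (a - z l)⁻¹ * (X l * polyH m s P)) * hc

/-- The condition on `2` is restricted to pairs `s ≠ l` because for `n = 1` the characteristic may
be `2`. -/
theorem polyHam_polyL_mul (h2 : ∀ s l : Fin n, s ≠ l → (2 : F) ≠ 0) (m : Fin n → ℕ)
    {z : Fin n → F} (hz : Function.Injective z) {a : F} (ha : ∀ s, a ≠ z s) (s : Fin n)
    (P : MvPolynomial (Fin n) F) :
    polyHam m z s (polyL z a * P) = polyL z a * polyHam m z s P +
      C (a - z s)⁻¹ * (polyL z a * polyH m s P - X s * ∑ l, C (a - z l)⁻¹ * polyH m l P) := by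
  have e : polyL z a * polyH m s P - X s * ∑ l, C (a - z l)⁻¹ * polyH m l P =
      ∑ l ∈ univ.erase s, C (a - z l)⁻¹ * (X l * polyH m s P - X s * polyH m l P) := by
    -- The summand with `l = s` is zero, so the sum may run over all `l`.
    rw [sum_erase _ (by simp), polyL, sum_mul, mul_sum, ← sum_sub_distrib]
    exact sum_congr rfl fun l _ => by ring
  rw [e, polyHam, polyHam, mul_sum, mul_sum, ← sum_add_distrib]
  refine sum_congr rfl fun l hl => ?_
  have hsl := (ne_of_mem_erase hl).symm
  have hc : C (z s - z l)⁻¹ * (C (a - z s)⁻¹ - C (a - z l)⁻¹) =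
      (C (a - z s)⁻¹ * C (a - z l)⁻¹ : MvPolynomial (Fin n) F) := by
    rw [← C_sub, ← C_mul, ← C_mul]
    congr 1
    have h1 := sub_ne_zero.2 (hz.ne hsl)
    have h3 := sub_ne_zero.2 (ha s)
    have h4 := sub_ne_zero.2 (ha l)
    field_simp
    ring
  rw [polyOmega_polyL_mul (h2 s l hsl) m z a hsl]
  linear_combination (X l * polyH m s P - X s * polyH m l P) * hc

/-- On `1` the operators `e` vanish and `h_s` is `m_s`, which gives the constant part of the
eigenvalue. Adding `a`, the scalar part of `h_s` gives the new eigenvalue term and the defect part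
of `sum_polyH_polyPhi` the new term removing `a`; what remains updates the old defects. -/
theorem polyHam_polyPhi (h2 : ∀ s l : Fin n, s ≠ l → (2 : F) ≠ 0) (m : Fin n → ℕ)
    {z : Fin n → F} (hz : Function.Injective z) {t : ι → F} (ht : Function.Injective t)
    (htz : ∀ i s, t i ≠ z s) (s : Fin n) (T : Finset ι) :
    polyHam m z s (polyPhi z t T) =
      C (∑ l ∈ univ.erase s, ((m s : F) * (m l : F) / 2) / (z s - z l)
        - ∑ i ∈ T, (m s : F) / (z s - t i)) * polyPhi z t T +
      ∑ j ∈ T, C (betheDefect m z t T j * (t j - z s)⁻¹) * (X s * polyPhi z t (T.erase j)) := by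
  induction T using Finset.induction_on with
  | empty =>
    simp only [polyPhi, polyHam, polyOmega, polyE, polyH, prod_empty, sum_empty, pderiv_one,
      map_zero, mul_zero, mul_one, sub_zero, add_zero, zero_add, map_sum, pderiv_C, ← C_mul]
    refine sum_congr rfl fun l _ => congrArg _ ?_
    ring
  | insert a T h ih =>
    rw [sum_insert_erase (fun j S => C (betheDefect m z t (insert a T) j * (t j - z s)⁻¹) *
      (X s * polyPhi z t S)) h, polyPhi_insert z t h, polyHam_polyL_mul h2 m hz (htz a), ih,
      sum_polyH_polyPhi m z t ht htz h, polyH, pderiv_polyPhi, sum_insert h]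
    have key : ∀ j ∈ T, C (betheDefect m z t (insert a T) j * (t j - z s)⁻¹) *
          (X s * polyPhi z t (insert a (T.erase j))) =
        polyL z (t a) * (C (betheDefect m z t T j * (t j - z s)⁻¹) *
            (X s * polyPhi z t (T.erase j))) -
          C (t a - z s)⁻¹ * polyL z (t a) * (2 * X s) *
            (C (t j - z s)⁻¹ * polyPhi z t (T.erase j)) -
          C (t a - z s)⁻¹ * X s *
            (C (2 / (t a - t j)) * (polyL z (t a) * polyPhi z t (T.erase j))) := by
      intro j hj
      have hja : t a ≠ t j := fun e => h (ht e ▸ hj)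
      -- The increment `2/(t_j - t_a)` of the defect, divided by `t_j - z_s`, splits by partial
      -- fractions into the two remaining kinds of terms.
      have hc : betheDefect m z t (insert a T) j * (t j - z s)⁻¹ =
          betheDefect m z t T j * (t j - z s)⁻¹ - (t a - z s)⁻¹ * 2 * (t j - z s)⁻¹ -
            (t a - z s)⁻¹ * (2 / (t a - t j)) := by
        rw [betheDefect_insert m z t h hj]
        have h1 := sub_ne_zero.2 hja
        have h1' := sub_ne_zero.2 hja.symm
        have h3 := sub_ne_zero.2 (htz a s)
        have h4 := sub_ne_zero.2 (htz j s)
        rw [← neg_sub (t a) (t j)]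
        field_simp
        ring
      rw [hc, polyPhi_insert_erase z t h]
      simp only [C_sub, C_mul, map_ofNat]
      ring
    rw [sum_congr rfl key, sum_sub_distrib, sum_sub_distrib, ← mul_sum, ← mul_sum, ← mul_sum,
      ← neg_sub (t a) (z s), div_neg, div_eq_mul_inv (m s : F) (t a - z s)]
    simp only [C_sub, C_add, C_neg, C_mul]
    ring

/-! ### Symmetrization: the Bethe vector as a product of creation forms -/

variable {k : ℕ}

/-- The sizes of the fibres of `c`. -/
def fiberCard (c : Fin k → Fin n) (s : Fin n) : ℕ := #{i | c i = s}

/-- The permutations counted form a coset of the stabilizer of `f`, which permutes each fibre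
independently. A coset representative `τ` comes from matching fibres of equal size. -/
theorem card_perm_comp_eq {f c : Fin k → Fin n} (h : fiberCard c = fiberCard f) :
    #{σ : Equiv.Perm (Fin k) | f ∘ σ = c} = ∏ s, (fiberCard f s).factorial := by
  have hcard : ∀ s, Fintype.card {i // c i = s} = Fintype.card {i // f i = s} := fun s => by
    simpa only [Fintype.card_subtype, fiberCard] using congrFun h s
  let τ : Equiv.Perm (Fin k) := (Equiv.sigmaFiberEquiv c).symm.trans
    ((Equiv.sigmaCongrRight fun s => Fintype.equivOfCardEq (hcard s)).trans
      (Equiv.sigmaFiberEquiv f))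
  have hτ : f ∘ τ = c :=
    funext fun i => (Fintype.equivOfCardEq (hcard (c i)) ⟨i, rfl⟩).2
  have hst := DomMulAct.stabilizer_card f
  simp only [Fintype.card_subtype] at hst
  rw [← Fintype.card_subtype] at hst
  unfold fiberCard
  rw [← hst, ← Fintype.card_subtype]
  refine Fintype.card_congr ((Equiv.mulRight τ⁻¹).subtypeEquiv fun σ => ?_)
  rw [← hτ]
  constructor
  · intro hσ
    funext i
    simpa using congrFun hσ (τ⁻¹ i)
  · intro hσ
    funext i
    simpa using congrFun hσ (τ i)

theorem fiberCard_comp_perm (f : Fin k → Fin n) (σ : Equiv.Perm (Fin k)) :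
    fiberCard (f ∘ σ) = fiberCard f := by
  funext s
  refine card_bij (fun i _ => σ i) ?_ ?_ ?_
  · simp
  · simp
  · intro b hb
    exact ⟨σ⁻¹ b, by simpa using hb, by simp⟩

theorem sum_perm_comp {M : Type*} [AddCommMonoid M] (f : Fin k → Fin n)
    (G : (Fin k → Fin n) → M) :
    ∑ σ : Equiv.Perm (Fin k), G (f ∘ σ) =
      (∏ s, (fiberCard f s).factorial) • ∑ c with fiberCard c = fiberCard f, G c := by
  rw [← sum_fiberwise_of_maps_to (s := univ) (t := univ.filter fun c => fiberCard c = fiberCard f)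
    (g := fun σ : Equiv.Perm (Fin k) => f ∘ σ)
    fun σ _ => mem_filter.2 ⟨mem_univ _, fiberCard_comp_perm f σ⟩, smul_sum]
  refine sum_congr rfl fun c hc => ?_
  rw [← card_perm_comp_eq (mem_filter.1 hc).2, ← sum_const]
  exact sum_congr rfl fun σ hσ => congrArg G (mem_filter.1 hσ).2

/-- The map sending the positions in the `s`-th of consecutive blocks of sizes `J_s` to `s`. -/
def blockIndex (J : Fin n → ℕ) (h : ∑ s, J s = k) (q : Fin k) : Fin n :=
  (finSigmaFinEquiv.symm (Fin.cast h.symm q)).1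

theorem prod_blockIndex {M : Type*} [CommMonoid M] (J : Fin n → ℕ) (h : ∑ s, J s = k)
    (g : Fin n → Fin k → M) :
    ∏ s, ∏ i : Fin (J s), g s (Fin.cast h (finSigmaFinEquiv ⟨s, i⟩)) =
      ∏ q, g (blockIndex J h q) q := by
  subst h
  rw [← Fintype.prod_sigma' (fun s (i : Fin (J s)) => g s (Fin.cast rfl (finSigmaFinEquiv ⟨s, i⟩))),
    ← finSigmaFinEquiv.prod_comp]
  refine Fintype.prod_congr _ _ fun x => ?_
  simp [blockIndex]

theorem fiberCard_blockIndex (J : Fin n → ℕ) (h : ∑ s, J s = k) :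
    fiberCard (blockIndex J h) = J := by
  funext s
  -- In `Multiplicative ℕ`, the product of indicators of block `s` counts its positions.
  have := prod_blockIndex (M := Multiplicative ℕ) J h
    fun r _ => Multiplicative.ofAdd (if r = s then 1 else 0)
  rw [fiberCard, card_filter]
  have h2 := congrArg Multiplicative.toAdd this
  simp only [toAdd_prod, toAdd_ofAdd] at h2
  rw [← h2]
  simp

/-- Each assignment `c` with fibre sizes `J` arises from exactly `∏ j_s!` permutations, which
cancels the prefactor. -/
theorem weightFun_eq_sum (m : Fin n → ℕ) (t : Fin k → F) (z : Fin n → F) {J : Fin n → ℕ}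
    (hJ : J ∈ indexSet m k) (hJ0 : ∏ s, ((J s).factorial : F) ≠ 0) :
    weightFun m t z J = ∑ c : Fin k → Fin n with fiberCard c = J, ∏ i, (t i - z (c i))⁻¹ := by
  have hk := (mem_indexSet.1 hJ).2
  rw [weightFun, dif_pos hJ]
  have e : ∀ σ : Equiv.Perm (Fin k), ∏ s, ∏ i : Fin (J s),
      (t (σ (Fin.cast hk (finSigmaFinEquiv ⟨s, i⟩))) - z s)⁻¹ =
        ∏ i, (t i - z ((blockIndex J hk ∘ ⇑(σ⁻¹)) i))⁻¹ := by
    intro σ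
    rw [prod_blockIndex J hk fun s q => (t (σ q) - z s)⁻¹,
      ← Equiv.prod_comp σ fun i => (t i - z ((blockIndex J hk ∘ ⇑(σ⁻¹)) i))⁻¹]
    simp
  have e2 : ∑ σ : Equiv.Perm (Fin k), ∏ i, (t i - z ((blockIndex J hk ∘ ⇑(σ⁻¹)) i))⁻¹ =
      ∑ σ : Equiv.Perm (Fin k), ∏ i, (t i - z ((blockIndex J hk ∘ σ) i))⁻¹ :=
    Equiv.sum_comp (Equiv.inv (Equiv.Perm (Fin k)))
      fun σ => ∏ i, (t i - z ((blockIndex J hk ∘ ⇑σ) i))⁻¹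
  rw [sum_congr rfl fun σ _ => e σ, e2,
    sum_perm_comp (blockIndex J hk) fun c => ∏ i, (t i - z (c i))⁻¹, fiberCard_blockIndex,
    nsmul_eq_mul, Nat.cast_prod, inv_mul_cancel_left₀ hJ0]

theorem sum_fiberCard (c : Fin k → Fin n) : ∑ s, fiberCard c s = k := by
  simpa [fiberCard] using (card_eq_sum_card_fiberwise (f := c) (s := univ) (t := univ)
    fun _ _ => mem_univ _).symm

theorem polyPhi_univ (z : Fin n → F) (t : Fin k → F) :
    polyPhi z t univ = ∑ c : Fin k → Fin n,
      monomial (∑ i, Finsupp.single (c i) 1) (∏ i, (t i - z (c i))⁻¹) := by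
  simp only [polyPhi, polyL]
  rw [prod_univ_sum, Fintype.piFinset_univ]
  refine sum_congr rfl fun c _ => ?_
  rw [prod_mul_distrib, ← map_prod, ← mul_one (∏ i, (t i - z (c i))⁻¹), ← C_mul_monomial, mul_one,
    monomial_sum_one]
  rfl

theorem betheVector_eq_evalVec (m : Fin n → ℕ) (t : Fin k → F) (z : Fin n → F)
    (h : ∀ J ∈ indexSet m k, ∏ s, ((J s).factorial : F) ≠ 0) :
    betheVector m t z = evalVec F m (polyPhi z t univ) := by
  have e : ∀ c : Fin k → Fin n, (⇑(∑ i, Finsupp.single (c i) 1 : Fin n →₀ ℕ)) = fiberCard c := by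
    intro c
    funext s
    rw [Finsupp.finsetSum_apply, fiberCard, card_filter]
    simp only [Finsupp.single_apply]
  rw [polyPhi_univ, map_sum, betheVector]
  simp only [evalVec_monomial, e]
  have e2 : ∀ J ∈ indexSet m k, weightFun m t z J • fVec F m J =
      ∑ c : Fin k → Fin n, if fiberCard c = J then
        (∏ i, (t i - z (c i))⁻¹) • fVec F m (fiberCard c) else 0 := by
    intro J hJ
    rw [weightFun_eq_sum m t z hJ (h J hJ), sum_smul, ← sum_filter]
    exact sum_congr rfl fun c hc => by rw [(mem_filter.1 hc).2]
  rw [sum_congr rfl e2, sum_comm]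
  refine sum_congr rfl fun c _ => ?_
  rw [sum_ite_eq]
  split_ifs with hc
  · rfl
  -- An assignment outside the index set puts more than `m_s` points on some `s`, and there `f^j
  -- v_{m_s} = 0`.
  · rw [mem_indexSet, not_and_or, not_forall] at hc
    rcases hc with ⟨s, hs⟩ | hc
    · rw [fVec_eq_zero (not_le.1 hs), smul_zero]
    · exact absurd (sum_fiberCard c) hc

/-! ### Singularity, weight and eigenvalues of the Bethe vector -/

theorem betheDefect_univ {m : Fin n → ℕ} {t : Fin k → F} {z : Fin n → F}
    (ht : IsBetheSolution m t z) (i : Fin k) : betheDefect m z t univ i = 0 :=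
  ht.equation i

theorem tensorAct_slE_betheVector {m : Fin n → ℕ} {t : Fin k → F} {z : Fin n → F}
    (ht : IsBetheSolution m t z) (h : ∀ J ∈ indexSet m k, ∏ s, ((J s).factorial : F) ≠ 0) :
    tensorAct m (slE F) (betheVector m t z) = 0 := by
  rw [betheVector_eq_evalVec m t z h, tensorAct, LinearMap.sum_apply]
  simp only [actAt_slE_evalVec]
  rw [← map_sum, sum_polyE_polyPhi m z t ht.injective ht.ne]
  simp [betheDefect_univ ht]

theorem tensorAct_slH_betheVector (m : Fin n → ℕ) (t : Fin k → F) (z : Fin n → F) :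
    tensorAct m (slH F) (betheVector m t z) =
      ((∑ s, (m s : F)) - 2 * k) • betheVector m t z := by
  rw [betheVector, map_sum, smul_sum]
  refine sum_congr rfl fun J hJ => ?_
  rw [map_smul, tensorAct, LinearMap.sum_apply]
  simp only [actAt_slH_fVec]
  rw [← sum_smul, smul_comm, sum_sub_distrib, ← mul_sum, ← Nat.cast_sum univ J,
    (mem_indexSet.1 hJ).2]

theorem hamiltonian_betheVector (h2 : ∀ s l : Fin n, s ≠ l → (2 : F) ≠ 0) {m : Fin n → ℕ}
    {t : Fin k → F} {z : Fin n → F} (hz : Function.Injective z) (ht : IsBetheSolution m t z)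
    (h : ∀ J ∈ indexSet m k, ∏ s, ((J s).factorial : F) ≠ 0) (s : Fin n) :
    hamiltonian m z s (betheVector m t z) = eigenvalue m t z s • betheVector m t z := by
  rw [betheVector_eq_evalVec m t z h, hamiltonian_evalVec,
    polyHam_polyPhi h2 m hz ht.injective ht.ne, eigenvalue, ← map_smul, ← C_mul']
  simp [betheDefect_univ ht]

/-! ### Coordinates of `e` applied to the Bethe vector -/

/-- The linear functional on the tensor product reading off the coefficient of `f_J v_m`. -/
def coordVec (F : Type*) [Field F] {m J : Fin n → ℕ} (hJ : ∀ s, J s ≤ m s) :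
    TensorModule F m →ₗ[F] F :=
  PiTensorProduct.lift ((MultilinearMap.mkPiAlgebra F (Fin n) F).compLinearMap
    fun s => LinearMap.proj ⟨J s, Nat.lt_succ_of_le (hJ s)⟩)

theorem fPow_apply (i j : ℕ) (r : Fin (i + 1)) : fPow F i j r = if j = r then 1 else 0 := by
  rw [fPow]
  split_ifs with h1 h2 h2
  · subst h2; simp
  · exact Pi.single_eq_of_ne (fun e => h2 (by rw [e])) _
  · exact absurd (h2 ▸ r.2) h1
  · rfl

theorem coordVec_fVec {m J : Fin n → ℕ} (hJ : ∀ s, J s ≤ m s) (J' : Fin n → ℕ) :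
    coordVec F hJ (fVec F m J') = if J' = J then 1 else 0 := by
  rw [coordVec, fVec, PiTensorProduct.lift.tprod]
  simp only [MultilinearMap.compLinearMap_apply, MultilinearMap.mkPiAlgebra_apply,
    LinearMap.proj_apply, fPow_apply]
  rw [prod_ite_zero]
  simp [funext_iff]

theorem coordVec_tensorAct_slE_betheVector {m J : Fin n → ℕ} (hJ : ∀ s, J s ≤ m s)
    (t : Fin k → F) (z : Fin n → F) :
    coordVec F hJ (tensorAct m (slE F) (betheVector m t z)) =
      ∑ s, ((J s : F) + 1) * ((m s : F) - (J s : F)) * weightFun m t z (J + Pi.single s 1) := by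
  rw [tensorAct, LinearMap.sum_apply, map_sum]
  refine sum_congr rfl fun s _ => ?_
  rw [betheVector, map_sum, map_sum]
  simp only [map_smul, actAt_slE_fVec, coordVec_fVec, smul_eq_mul]
  rw [sum_eq_single (J + Pi.single s 1)]
  · have : Function.update (J + Pi.single s 1) s ((J + Pi.single s 1 : Fin n → ℕ) s - 1) = J := by
      funext r
      by_cases hr : r = s
      · subst hr; simp
      · simp [hr]
    rw [if_pos this]
    simp
    ring
  · intro J' _ hne
    -- If `J' s = 0`, truncated subtraction could still produce `J`, but the coefficient `J' s` is
    -- zero.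
    rcases Nat.eq_zero_or_pos (J' s) with h0 | h0
    · simp [h0]
    · rw [if_neg]
      · simp
      · rintro rfl
        apply hne
        funext r
        by_cases hr : r = s
        · subst hr; simp; omega
        · simp [hr]
  -- Outside the index set the weight function is zero by convention, consistent with the missing
  -- summand.
  · intro hn
    rw [weightFun, dif_neg hn, zero_mul]

/-! ### Invertibility of the denominators modulo `p` -/

theorem prod_factorial_ne_zero {p : ℕ} [Fact p.Prime] {m : Fin n → ℕ} (hp : ∑ s, m s < p)
    {J : Fin n → ℕ} (hJ : ∀ s, J s ≤ m s) : ∏ s, ((J s).factorial : ZMod p) ≠ 0 := by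
  refine prod_ne_zero_iff.2 fun s _ => ?_
  rw [Ne, ZMod.natCast_eq_zero_iff, (Fact.out : p.Prime).dvd_factorial, not_le]
  exact ((hJ s).trans (single_le_sum (fun _ _ => Nat.zero_le _) (mem_univ s))).trans_lt hp

/-- Two distinct factors with positive `m_s` force `|m| ≥ 2`, hence `p > 2`. -/
theorem two_ne_zero_of_sum_lt {p : ℕ} [Fact p.Prime] {m : Fin n → ℕ} (hm : ∀ s, 0 < m s)
    (hp : ∑ s, m s < p) {s l : Fin n} (h : s ≠ l) : (2 : ZMod p) ≠ 0 := by
  have h2 : m s + m l ≤ ∑ r, m r := by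
    rw [← sum_pair h]
    exact sum_le_sum_of_subset (subset_univ _)
  have := hm s
  have := hm l
  intro e
  have e' : ((2 : ℕ) : ZMod p) = 0 := by exact_mod_cast e
  have := Nat.le_of_dvd two_pos ((ZMod.natCast_eq_zero_iff 2 p).1 e')
  omega

end GaudinModel

end

theorem theorem2p3 (p : ℕ) [Fact p.Prime] (k n : ℕ) (hk : 0 < k) (hn : 0 < n)
    (m : Fin n → ℕ) (hm : ∀ s, 0 < m s) (hp : ∑ s, m s < p)
    (z : Fin n → ZMod p) (hz : Function.Injective z)
    (t : Fin k → ZMod p) (ht : GaudinModel.IsBetheSolution m t z) :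
    GaudinModel.BetheVectorDefined m t z ∧
    GaudinModel.betheVector m t z ∈
      GaudinModel.singSpace (ZMod p) m (((∑ s, m s : ℕ) : ℤ) - 2 * (k : ℤ)) ∧
    (∀ J ∈ GaudinModel.indexSet m (k - 1),
      ∑ s, ((J s : ZMod p) + 1) * ((m s : ZMod p) - (J s : ZMod p)) *
        GaudinModel.weightFun m t z (J + Pi.single s 1) = 0) ∧
    ∀ s, GaudinModel.hamiltonian m z s (GaudinModel.betheVector m t z) =
      GaudinModel.eigenvalue m t z s • GaudinModel.betheVector m t z := by
  have hfac : ∀ J ∈ GaudinModel.indexSet m k, ∏ s, ((J s).factorial : ZMod p) ≠ 0 :=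
    fun J hJ => GaudinModel.prod_factorial_ne_zero hp (GaudinModel.mem_indexSet.1 hJ).1
  have hE := GaudinModel.tensorAct_slE_betheVector ht hfac
  refine ⟨⟨fun i s => sub_ne_zero.2 (ht.ne i s), hfac⟩, ⟨?_, hE⟩, fun J hJ => ?_, fun s => ?_⟩
  · rw [SetLike.mem_coe, GaudinModel.weightSpace, LinearMap.mem_ker, LinearMap.sub_apply,
      GaudinModel.tensorAct_slH_betheVector, LinearMap.smul_apply, Module.End.one_apply]
    push_cast
    exact sub_self _
  · rw [← GaudinModel.coordVec_tensorAct_slE_betheVector (GaudinModel.mem_indexSet.1 hJ).1, hE,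
      map_zero]
  · exact GaudinModel.hamiltonian_betheVector
      (fun _ _ h => GaudinModel.two_ne_zero_of_sum_lt hm hp h) hz ht hfac s
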